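/- Let $k\ge 2$ and let $H$ be a finite simple graph with chromatic number $\chi(H)=k+1$ that has a critical edge, that is, an edge $e$ with $\chi(H-e)=\chi(H)-1$. Let $t_k(n)$ denote the number of edges of the $k$-partite Turán graph $T_k(n)$, the complete $k$-partite graph on $n$ vertices whose vertex classes are as equal in size as possible. Then there is a constant $C>0$, depending only on $H$, such that for every function $f:\mathbb{N}\to[0,\infty)$ with $f(n)=o(n^2)$ there is an $n_0$ for which the following holds. If $n\ge n_0$ and $G$ is a simple graph on $n$ vertices that contains no copy of $H$ as a (not necessarily induced) subgraph and has $$e(G)\ \ge\ t_k(n)-f(n)$$ edges, then $G$ can be made $k$-partite by deleting at most $C\,n^{-1}f(n)^{3/2}$ edges. -/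

import Mathlib

open Filter Asymptotics

/-- An edge `e` of `H` is critical if `χ(H - e) = χ(H) - 1` (written without subtraction). -/
def SimpleGraph.IsCriticalEdge {W : Type*} (H : SimpleGraph W) (e : Sym2 W) : Prop :=
  e ∈ H.edgeSet ∧ (H.deleteEdges {e}).chromaticNumber + 1 = H.chromaticNumber

/-- `t_k(n)`, the number of edges of the `k`-partite Turán graph on `n` vertices. -/
def turanNumber (k n : ℕ) : ℕ := (SimpleGraph.turanGraph n k).edgeFinset.card

/-- `G` can be made `k`-partite by deleting at most `r` edges. -/
def SimpleGraph.PartiteAfterDeleting {V : Type*} (G : SimpleGraph V) (k : ℕ) (r : ℝ) : Prop :=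
  ∃ s : Finset (Sym2 V), (s : Set (Sym2 V)) ⊆ G.edgeSet ∧ (s.card : ℝ) ≤ r ∧
    (G.deleteEdges (s : Set (Sym2 V))).Colorable k

/-!
Let `s = |W| + 2`. Since `H` has a critical edge, it embeds into a complete `k`-partite graph with
parts of size `s` to which one edge inside a part is added, so an `H`-free graph `G` is
`MultipartiteEdgeFree k s`. The rest of the proof uses only this property.

*Stability* (`exists_card_insidePairs_le`). If `G` has at least `(1 - 1 / k - δ) n ^ 2 / 2` edges,
then few vertices have degree much below `(1 - 1 / k) n`, and by the Erdős–Stone theorem the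
remaining vertices contain a complete `k`-partite graph with parts `A i` of a large constant size
`T`. No vertex has `s` neighbours in every part, so each vertex `v` may be coloured by a part in
which it has fewer than `s` neighbours. Two adjacent vertices of colour `j` cannot both be joined
to more than half of every other part, since together with `A j` and their common neighbours they
would form the forbidden configuration. Counting the edges that leave the sets `A i` shows that all
but a small proportion of the vertices are joined to more than half of every other part. So there
is a colouring with at most `ε n ^ 2` ordered monochromatic adjacent pairs.

*The bound* (`card_insidePairs_mul_le`). Take a colouring with the fewest monochromatic edges, let
`I` count its ordered monochromatic adjacent pairs, and `M` the ordered bichromatic nonadjacent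
pairs. Comparing with the Turán graph gives `M ≤ I + 2 f`. By a counting argument
(`exists_isCompleteFamily_of_card_missingPairs_lt`), sets of size `d`, one in each colour class,
contain a complete `k`-partite graph with parts of size `s` unless `M` is at least about
`(d / s) ^ 2`. This has two consequences. A vertex with `d` neighbours of its own colour has, by minimality,
`d` neighbours of every colour, so `d = O(√M)`. And as `M` is a small multiple of `n ^ 2`, the ends
of a monochromatic edge do not have linearly many common neighbours in every other class, so one of
them lies in linearly many missing pairs; there are only `O(M / n)` such vertices. Hence
`I = O(M √M / n)`. Because `√M` is a small multiple of `n`, this yields `I ≤ M / 2`, so `M ≤ 4 f`, and then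
`I = O(f ^ (3 / 2) / n)`.
-/

namespace SimpleGraph

/-! ### Complete families and the forbidden configuration -/

section Multipartite
open Finset

variable {V W : Type*}

/-- The sets `A i` are pairwise completely joined in `G`. -/
def IsCompleteFamily (G : SimpleGraph V) {ι : Type*} (A : ι → Finset V) : Prop :=
  ∀ i j, i ≠ j → ∀ x ∈ A i, ∀ y ∈ A j, G.Adj x y

theorem IsCompleteFamily.mono {G : SimpleGraph V} {ι : Type*} {A B : ι → Finset V}
    (hA : G.IsCompleteFamily A) (h : ∀ i, B i ⊆ A i) : G.IsCompleteFamily B :=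
  fun i j hij x hx y hy => hA i j hij x (h i hx) y (h j hy)

/-- `G` contains no complete `k`-partite graph with parts of size at least `s` together with an
additional edge `uv` placed in the part `j`. The ends of the edge need not lie in `A j`; they only
have to be joined to all the other parts. -/
def MultipartiteEdgeFree (G : SimpleGraph V) (k s : ℕ) : Prop :=
  ∀ (A : Fin k → Finset V) (j : Fin k) (u v : V), G.Adj u v → G.IsCompleteFamily A →
    (∀ i, i ≠ j → ∀ y ∈ A i, G.Adj u y ∧ G.Adj v y) → ∃ i, #(A i) < s

theorem IsCriticalEdge.exists_coloring {H : SimpleGraph W} {k : ℕ} {e : Sym2 W}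
    (hχ : H.chromaticNumber = ((k + 1 : ℕ) : ℕ∞)) (he : H.IsCriticalEdge e) :
    ∃ (c : W → Fin k) (a b : W), H.Adj a b ∧ c a = c b ∧
      ∀ x y, H.Adj x y → s(x, y) ≠ s(a, b) → c x ≠ c y := by
  induction e with | _ a b
  obtain ⟨hab, hc⟩ := he
  rw [hχ, Nat.cast_add, Nat.cast_one] at hc
  have hk : (H.deleteEdges {s(a, b)}).chromaticNumber = k :=
    WithTop.add_right_cancel ENat.one_ne_top hc
  obtain ⟨c⟩ : (H.deleteEdges {s(a, b)}).Colorable k :=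
    chromaticNumber_le_iff_colorable.1 hk.le
  have hne : ∀ x y, H.Adj x y → s(x, y) ≠ s(a, b) → c x ≠ c y := fun x y hxy h =>
    c.valid (deleteEdges_adj.2 ⟨hxy, by simpa using h⟩)
  refine ⟨c, a, b, hab, ?_, hne⟩
  by_contra hcab
  have hcol : H.Colorable k := ⟨Coloring.mk c fun {x y} hxy => by
    by_cases h : s(x, y) = s(a, b)
    · rcases Sym2.eq_iff.1 h with ⟨rfl, rfl⟩ | ⟨rfl, rfl⟩
      · exact hcab
      · exact Ne.symm hcab
    · exact hne x y hxy h⟩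
  have := chromaticNumber_le_iff_colorable.2 hcol
  rw [hχ, Nat.cast_le] at this
  omega

/-- A graph with a critical edge embeds into a complete `k`-partite graph with large parts plus an
edge in one of the parts. -/
theorem Free.multipartiteEdgeFree [Fintype W] {H : SimpleGraph W} {G : SimpleGraph V} {k : ℕ}
    {e : Sym2 W} (hχ : H.chromaticNumber = ((k + 1 : ℕ) : ℕ∞)) (he : H.IsCriticalEdge e)
    (hG : H.Free G) : G.MultipartiteEdgeFree k (Fintype.card W + 2) := by
  classical
  intro A j u v huv hA hj
  by_contra! hbig
  obtain ⟨c₀, a, b, hab, hcab, hc₀⟩ := he.exists_coloring hχ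
  apply hG
  -- permute the colours so that the critical edge receives colour `j`
  obtain ⟨c, hca, hcb, hc⟩ : ∃ c : W → Fin k, c a = j ∧ c b = j ∧
      ∀ x y, H.Adj x y → s(x, y) ≠ s(a, b) → c x ≠ c y :=
    ⟨fun x => Equiv.swap (c₀ a) j (c₀ x), by simp, by simp [← hcab], fun x y hxy h => by
      simpa using hc₀ x y hxy h⟩
  have hemb (i : Fin k) : Nonempty (W ↪ (A i \ {u, v} : Finset V)) := by
    rw [Function.Embedding.nonempty_iff_card_le, Fintype.card_coe]
    have h1 := le_card_sdiff ({u, v} : Finset V) (A i)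
    have h2 : #({u, v} : Finset V) ≤ 2 := card_le_two
    have h3 := hbig i
    omega
  let F : ∀ i, W ↪ (A i \ {u, v} : Finset V) := fun i => (hemb i).some
  have hF (w : W) : (F (c w) w : V) ∈ A (c w) ∧ (F (c w) w : V) ≠ u ∧ (F (c w) w : V) ≠ v := by
    have := (F (c w) w).2
    rw [Finset.mem_sdiff, Finset.mem_insert, Finset.mem_singleton, not_or] at this
    exact this
  let φ : W → V := fun w => if w = a then u else if w = b then v else F (c w) w
  have hba : b ≠ a := hab.ne'
  have φa : φ a = u := by simp [φ]
  have φb : φ b = v := by simp [φ, hba]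
  have φw (w : W) (h1 : w ≠ a) (h2 : w ≠ b) : φ w = F (c w) w := by simp [φ, h1, h2]
  have hadj (x y : W) (hxy : H.Adj x y) : G.Adj (φ x) (φ y) := by
    -- by symmetry, it is enough to treat the edges whose first end is not an end of `ab`
    have aux (x y : W) (hxy : H.Adj x y) (hxa : x ≠ a) (hxb : x ≠ b) : G.Adj (φ x) (φ y) := by
      have hne : c x ≠ c y := hc x y hxy (by
        intro h
        rcases Sym2.eq_iff.1 h with h | h
        · exact hxa h.1
        · exact hxb h.1)
      rw [φw x hxa hxb]
      by_cases hya : y = a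
      · subst hya
        rw [φa]
        exact (hj _ (hca ▸ hne) _ (hF x).1).1.symm
      by_cases hyb : y = b
      · subst hyb
        rw [φb]
        exact (hj _ (hcb ▸ hne) _ (hF x).1).2.symm
      rw [φw y hya hyb]
      exact hA _ _ hne _ (hF x).1 _ (hF y).1
    by_cases hx : x ≠ a ∧ x ≠ b
    · exact aux x y hxy hx.1 hx.2
    by_cases hy : y ≠ a ∧ y ≠ b
    · exact (aux y x hxy.symm hy.1 hy.2).symm
    have hne := hxy.ne
    have hx' : x = a ∨ x = b := by tauto
    have hy' : y = a ∨ y = b := by tauto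
    rcases hx' with rfl | rfl <;> rcases hy' with rfl | rfl
    · exact absurd rfl hne
    · rwa [φa, φb]
    · rw [φa, φb]; exact huv.symm
    · exact absurd rfl hne
  refine ⟨⟨⟨φ, fun {x y} => hadj x y⟩, ?_⟩⟩
  intro x y hxy
  change φ x = φ y at hxy
  by_contra hne
  by_cases hxa : x = a
  · subst hxa
    rw [φa] at hxy
    by_cases hyb : y = b
    · subst hyb
      rw [φb] at hxy
      exact huv.ne hxy
    · rw [φw y (Ne.symm hne) hyb] at hxy
      exact (hF y).2.1 hxy.symm
  by_cases hxb : x = b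
  · subst hxb
    rw [φb] at hxy
    by_cases hya : y = a
    · subst hya
      rw [φa] at hxy
      exact huv.ne hxy.symm
    · rw [φw y hya (Ne.symm hne)] at hxy
      exact (hF y).2.2 hxy.symm
  rw [φw x hxa hxb] at hxy
  by_cases hya : y = a
  · subst hya
    rw [φa] at hxy
    exact (hF x).2.1 hxy
  by_cases hyb : y = b
  · subst hyb
    rw [φb] at hxy
    exact (hF x).2.2 hxy
  rw [φw y hya hyb] at hxy
  by_cases hcxy : c x = c y
  · rw [hcxy] at hxy
    exact hne ((F (c y)).injective (Subtype.ext hxy))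
  · exact (hA _ _ hcxy _ (hF x).1 _ (hF y).1).ne hxy

/-- A vertex joined to all of a complete family would serve as one end of the additional edge. -/
theorem MultipartiteEdgeFree.exists_card_lt_of_adj {G : SimpleGraph V} {k s : ℕ}
    (hG : G.MultipartiteEdgeFree k s) (hk : 0 < k) (hs : 0 < s) {A : Fin k → Finset V}
    (hA : G.IsCompleteFamily A) {v : V} (hv : ∀ i, ∀ y ∈ A i, G.Adj v y) :
    ∃ i, #(A i) < s := by
  by_contra! h
  obtain ⟨w, hw⟩ : (A ⟨0, hk⟩).Nonempty := card_pos.1 (hs.trans_le (h _))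
  obtain ⟨i, hi⟩ := hG A ⟨0, hk⟩ v w (hv _ w hw) hA fun i hi y hy =>
    ⟨hv i y hy, hA _ _ hi.symm w hw y hy⟩
  exact (h i).not_gt hi

section Coloured

variable [Fintype V]

/-- The ordered pairs of adjacent vertices with the same colour; every monochromatic edge is counted
twice. -/
def insidePairs (G : SimpleGraph V) [DecidableRel G.Adj] {k : ℕ} (c : V → Fin k) :
    Finset (V × V) :=
  {p | G.Adj p.1 p.2 ∧ c p.1 = c p.2}

/-- The ordered pairs of nonadjacent vertices with different colours. -/
def missingPairs (G : SimpleGraph V) [DecidableRel G.Adj] {k : ℕ} (c : V → Fin k) :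
    Finset (V × V) :=
  {p | ¬ G.Adj p.1 p.2 ∧ c p.1 ≠ c p.2}

theorem sq_mul_card_le_pow_of_forall_apply_eq {k q : ℕ} {i j : Fin k} (hij : i ≠ j) (x y : Fin q)
    (S : Finset (Fin k → Fin q)) (hS : ∀ g ∈ S, g i = x ∧ g j = y) : q ^ 2 * #S ≤ q ^ k := by
  have h := card_le_card_of_injOn
    (s := (univ : Finset (Fin q × Fin q)) ×ˢ S) (t := (univ : Finset (Fin k → Fin q)))
    (fun z => Function.update (Function.update z.2 i z.1.1) j z.1.2) (by simp)
    (by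
      rintro ⟨⟨a, b⟩, g⟩ hg ⟨⟨a', b'⟩, g'⟩ hg' h
      simp only [coe_product, coe_univ, Set.mem_prod, Set.mem_univ, true_and, mem_coe] at hg hg'
      have hl (l : Fin k) := congrFun h l
      have hb : b = b' := by simpa using hl j
      have ha : a = a' := by simpa [hij] using hl i
      have hgg : g = g' := by
        funext l
        by_cases h1 : l = j
        · rw [h1, (hS g hg).2, (hS g' hg').2]
        by_cases h2 : l = i
        · rw [h2, (hS g hg).1, (hS g' hg').1]
        simpa [h1, h2] using hl l
      rw [ha, hb, hgg])
  simpa [card_product, sq] using h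

/-- Each of the given sets is cut into `d / s` blocks of size `s`. There are `(d / s) ^ k` ways to
choose one block from each set, and one missing pair spoils at most `(d / s) ^ (k - 2)` of them, so
with fewer than `(d / s) ^ 2` missing pairs some choice is a complete family. -/
theorem exists_isCompleteFamily_of_card_missingPairs_lt [DecidableEq V] (G : SimpleGraph V)
    [DecidableRel G.Adj] {k d s : ℕ} (c : V → Fin k) {A : Fin k → Finset V}
    (hA : ∀ i, ∀ x ∈ A i, c x = i)
    (hd : ∀ i, d ≤ #(A i)) (hM : #(G.missingPairs c) < (d / s) ^ 2) :
    ∃ B : Fin k → Finset V, (∀ i, B i ⊆ A i) ∧ (∀ i, #(B i) = s) ∧ G.IsCompleteFamily B := by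
  set q := d / s with hq
  have hemb (i : Fin k) : Nonempty (Fin q × Fin s ↪ A i) := by
    rw [Function.Embedding.nonempty_iff_card_le, Fintype.card_coe, Fintype.card_prod,
      Fintype.card_fin, Fintype.card_fin]
    exact (Nat.div_mul_le_self d s).trans (hd i)
  let F : ∀ i, Fin q × Fin s ↪ A i := fun i => (hemb i).some
  let B : (Fin k → Fin q) → Fin k → Finset V := fun g i => univ.image fun b => (F i (g i, b) : V)
  have hBA (g i) : B g i ⊆ A i := by
    intro x hx
    obtain ⟨b, -, rfl⟩ := mem_image.1 hx
    exact (F i (g i, b)).2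
  have hBs (g i) : #(B g i) = s := by
    rw [card_image_of_injective, card_univ, Fintype.card_fin]
    intro b b' h
    simpa using (F i).injective (Subtype.ext h)
  by_contra! hno
  have hcover : (univ : Finset (Fin k → Fin q)) ⊆ (G.missingPairs c).biUnion fun p =>
      {g | p.1 ∈ B g (c p.1) ∧ p.2 ∈ B g (c p.2)} := by
    intro g _
    have := hno (B g) (hBA g) (hBs g)
    simp only [IsCompleteFamily] at this
    push Not at this
    obtain ⟨i, j, hij, x, hx, y, hy, hxy⟩ := this
    have hcx := hA i x (hBA g i hx)
    have hcy := hA j y (hBA g j hy)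
    subst hcx hcy
    simp only [mem_biUnion, missingPairs, mem_filter, mem_univ, true_and]
    exact ⟨(x, y), ⟨hxy, hij⟩, hx, hy⟩
  have hspoil (p) (hp : p ∈ G.missingPairs c) :
      q ^ 2 * #{g : Fin k → Fin q | p.1 ∈ B g (c p.1) ∧ p.2 ∈ B g (c p.2)} ≤ q ^ k := by
    have hp' : c p.1 ≠ c p.2 := (mem_filter.1 hp).2.2
    rcases eq_empty_or_nonempty {g : Fin k → Fin q | p.1 ∈ B g (c p.1) ∧ p.2 ∈ B g (c p.2)}
      with h | ⟨g₀, hg₀⟩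
    · simp [h]
    -- the block containing a given vertex is determined by the vertex
    have hdet (g g' : Fin k → Fin q) (z : V) (hz : z ∈ B g (c z)) (hz' : z ∈ B g' (c z)) :
        g (c z) = g' (c z) := by
      obtain ⟨b, -, hb⟩ := mem_image.1 hz
      obtain ⟨b', -, hb'⟩ := mem_image.1 hz'
      have := (F (c z)).injective (Subtype.ext (hb.trans hb'.symm))
      exact (Prod.ext_iff.1 this).1
    simp only [mem_filter, mem_univ, true_and] at hg₀
    refine sq_mul_card_le_pow_of_forall_apply_eq hp' (g₀ (c p.1)) (g₀ (c p.2)) _ ?_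
    intro g hg
    simp only [mem_filter, mem_univ, true_and] at hg
    exact ⟨hdet g g₀ p.1 hg.1 hg₀.1, hdet g g₀ p.2 hg.2 hg₀.2⟩
  have hqpos : 0 < q := by
    rw [Nat.pos_iff_ne_zero]
    intro h0
    simp [h0] at hM
  have h1 : q ^ k ≤ ∑ p ∈ G.missingPairs c,
      #{g : Fin k → Fin q | p.1 ∈ B g (c p.1) ∧ p.2 ∈ B g (c p.2)} := by
    have := (card_le_card hcover).trans card_biUnion_le
    simpa using this
  have h2 : q ^ 2 * q ^ k ≤ #(G.missingPairs c) * q ^ k := by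
    calc q ^ 2 * q ^ k ≤ q ^ 2 * _ := Nat.mul_le_mul_left _ h1
      _ = ∑ p ∈ G.missingPairs c,
          q ^ 2 * #{g : Fin k → Fin q | p.1 ∈ B g (c p.1) ∧ p.2 ∈ B g (c p.2)} := mul_sum _ _ _
      _ ≤ ∑ p ∈ G.missingPairs c, q ^ k := sum_le_sum hspoil
      _ = _ := by simp
  exact hM.not_ge (Nat.le_of_mul_le_mul_right h2 (pow_pos hqpos k))

/-- A vertex with many neighbours in every colour class forces many missing pairs. -/
theorem MultipartiteEdgeFree.sq_le_card_missingPairs_of_vertex {G : SimpleGraph V}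
    [DecidableRel G.Adj] {k s d : ℕ} (hG : G.MultipartiteEdgeFree k s) (hk : 0 < k) (hs : 0 < s)
    (c : V → Fin k) (v : V) (hd : ∀ i, d ≤ #{w | G.Adj v w ∧ c w = i}) :
    (d / s) ^ 2 ≤ #(G.missingPairs c) := by
  classical
  by_contra! hM
  obtain ⟨B, hBA, hBs, hB⟩ := G.exists_isCompleteFamily_of_card_missingPairs_lt c
    (A := fun i => {w | G.Adj v w ∧ c w = i}) (fun i x hx => (mem_filter.1 hx).2.2) hd hM
  obtain ⟨i, hi⟩ := hG.exists_card_lt_of_adj hk hs hB (v := v)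
    fun i y hy => (mem_filter.1 (hBA i hy)).2.1
  exact hi.ne (hBs i)

/-- A monochromatic edge whose ends have many common neighbours in every other colour class forces
many missing pairs. -/
theorem MultipartiteEdgeFree.sq_le_card_missingPairs_of_edge {G : SimpleGraph V}
    [DecidableRel G.Adj] {k s d : ℕ} (hG : G.MultipartiteEdgeFree k s)
    (c : V → Fin k) {u v : V} (huv : G.Adj u v) (j : Fin k) (hj : d ≤ #{w | c w = j})
    (hd : ∀ i, i ≠ j → d ≤ #{w | G.Adj u w ∧ G.Adj v w ∧ c w = i}) :
    (d / s) ^ 2 ≤ #(G.missingPairs c) := by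
  classical
  by_contra! hM
  obtain ⟨B, hBA, hBs, hB⟩ := G.exists_isCompleteFamily_of_card_missingPairs_lt c
    (A := fun i => if i = j then ({w | c w = j} : Finset V)
      else ({w | G.Adj u w ∧ G.Adj v w ∧ c w = i} : Finset V))
    (by
      intro i x hx
      by_cases h : i = j
      · simp only [h, if_true, mem_filter, mem_univ, true_and] at hx ⊢
        exact hx
      · simp only [h, if_false, mem_filter, mem_univ, true_and] at hx
        exact hx.2.2)
    (by
      intro i
      by_cases h : i = j
      · simpa only [h, if_true] using hj
      · simpa only [h, if_false] using hd i h)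
    hM
  obtain ⟨i, hi⟩ := hG B j u v huv hB fun i hi y hy => by
    have := hBA i hy
    simp only [hi, if_false, mem_filter, mem_univ, true_and] at this
    exact ⟨this.1, this.2.1⟩
  exact hi.ne (hBs i)

end Coloured

end Multipartite

/-! ### The Erdős–Stone theorem inside a set of vertices -/

section ErdosStone
open Finset

universe u
variable {V : Type u}

theorem card_filter_adj_product (G : SimpleGraph V) [DecidableRel G.Adj] (S T : Finset V) :
    #{p ∈ S ×ˢ T | G.Adj p.1 p.2} = ∑ v ∈ S, #{w ∈ T | G.Adj v w} := by
  simp only [card_filter, sum_product]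

theorem card_filter_adj_le_sdiff [DecidableEq V] (G : SimpleGraph V) [DecidableRel G.Adj]
    (S L : Finset V) :
    #{p ∈ S ×ˢ S | G.Adj p.1 p.2} ≤
      #{p ∈ (S \ L) ×ˢ (S \ L) | G.Adj p.1 p.2} + 2 * ∑ v ∈ L, #{w ∈ S | G.Adj v w} := by
  have hsub : {p ∈ S ×ˢ S | G.Adj p.1 p.2} ⊆ {p ∈ (S \ L) ×ˢ (S \ L) | G.Adj p.1 p.2} ∪
      ({p ∈ L ×ˢ S | G.Adj p.1 p.2} ∪ {p ∈ L ×ˢ S | G.Adj p.1 p.2}.image Prod.swap) := by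
    rintro ⟨x, y⟩ h
    simp only [mem_filter, mem_product] at h
    simp only [mem_union, mem_filter, mem_product, Finset.mem_sdiff, mem_image, Prod.exists,
      Prod.swap_prod_mk, Prod.mk.injEq]
    by_cases hx : x ∈ L
    · exact Or.inr (Or.inl ⟨⟨hx, h.1.2⟩, h.2⟩)
    by_cases hy : y ∈ L
    · exact Or.inr (Or.inr ⟨y, x, ⟨⟨hy, h.1.1⟩, h.2.symm⟩, rfl, rfl⟩)
    · exact Or.inl ⟨⟨⟨h.1.1, hx⟩, h.1.2, hy⟩, h.2⟩
  have h1 := card_le_card hsub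
  have h2 := card_union_le {p ∈ (S \ L) ×ˢ (S \ L) | G.Adj p.1 p.2}
    ({p ∈ L ×ˢ S | G.Adj p.1 p.2} ∪ {p ∈ L ×ˢ S | G.Adj p.1 p.2}.image Prod.swap)
  have h3 := card_union_le {p ∈ L ×ˢ S | G.Adj p.1 p.2}
    ({p ∈ L ×ˢ S | G.Adj p.1 p.2}.image Prod.swap)
  have h4 : #({p ∈ L ×ˢ S | G.Adj p.1 p.2}.image Prod.swap) ≤ #{p ∈ L ×ˢ S | G.Adj p.1 p.2} :=
    card_image_le
  rw [← card_filter_adj_product]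
  omega

/-- The minimum degree form of the Erdős–Stone theorem, inside a set of vertices. -/
theorem exists_isCompleteFamily_of_le_degree {ε : ℝ} (hε : 0 < ε) (r t : ℕ) :
    ∃ N : ℕ, ∀ {V : Type u} [DecidableEq V] (G : SimpleGraph V) [DecidableRel G.Adj]
      (S : Finset V), N ≤ #S →
      (∀ v ∈ S, (1 - 1 / r + ε) * #S ≤ (#{w ∈ S | G.Adj v w} : ℝ)) →
      ∃ A : Fin (r + 1) → Finset V, (∀ i, A i ⊆ S) ∧ (∀ i, #(A i) = t) ∧
        G.IsCompleteFamily A := by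
  obtain ⟨N, hN⟩ := eventually_atTop.1
    (eventually_completeEquipartiteGraph_isContained_of_minDegree hε r t)
  refine ⟨N + 1, fun {V} _ G _ S hS hdeg => ?_⟩
  let φ : Fin #S → V := fun i => (S.equivFin.symm i : V)
  have hφ : Function.Injective φ := fun i j h => S.equivFin.symm.injective (Subtype.ext h)
  have hφS (i) : φ i ∈ S := (S.equivFin.symm i).2
  have : Nonempty (Fin #S) := ⟨⟨0, by omega⟩⟩
  have hdegree (i : Fin #S) : (G.comap φ).degree i = #{w ∈ S | G.Adj (φ i) w} := by
    rw [← card_neighborFinset_eq_degree, ← card_image_of_injective _ hφ]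
    congr 1
    ext w
    simp only [mem_image, mem_neighborFinset, comap_adj, mem_filter]
    constructor
    · rintro ⟨j, hj, rfl⟩
      exact ⟨hφS j, hj⟩
    · rintro ⟨hw, h⟩
      refine ⟨S.equivFin ⟨w, hw⟩, ?_, ?_⟩ <;> simp [φ, h]
  obtain ⟨f⟩ := hN #S (by omega) (G := G.comap φ) (by
    obtain ⟨i, hi⟩ := (G.comap φ).exists_minimal_degree_vertex
    rw [hi, hdegree]
    exact hdeg _ (hφS i))
  refine ⟨fun i => univ.image fun b => φ (f (i, b)), fun i x hx => ?_, fun i => ?_, ?_⟩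
  · obtain ⟨b, -, rfl⟩ := mem_image.1 hx
    exact hφS _
  · rw [card_image_of_injective, card_univ, Fintype.card_fin]
    intro b b' h
    simpa using f.injective (hφ h)
  · intro i j hij x hx y hy
    obtain ⟨b, -, rfl⟩ := mem_image.1 hx
    obtain ⟨b', -, rfl⟩ := mem_image.1 hy
    exact f.toHom.map_adj (v := (i, b)) (w := (j, b')) hij

/-- The edge density form of the Erdős–Stone theorem, inside a set of vertices. It follows from the
minimum degree form by removing vertices of small degree one at a time: each removal increases the
density, so it must stop before the set becomes small. -/
theorem exists_isCompleteFamily_of_lt_card_adj {ε : ℝ} (hε : 0 < ε) (r t : ℕ) :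
    ∃ N : ℕ, ∀ {V : Type u} [DecidableEq V] (G : SimpleGraph V) [DecidableRel G.Adj]
      (S : Finset V), N ≤ #S →
      (1 - 1 / r + ε) * (#S : ℝ) ^ 2 < (#{p ∈ S ×ˢ S | G.Adj p.1 p.2} : ℝ) →
      ∃ A : Fin (r + 1) → Finset V, (∀ i, A i ⊆ S) ∧ (∀ i, #(A i) = t) ∧
        G.IsCompleteFamily A := by
  obtain ⟨N₀, hN₀⟩ := exists_isCompleteFamily_of_le_degree.{u} (half_pos hε) r t
  set b : ℝ := 1 - 1 / r with hb
  have hb1 : b ≤ 1 := by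
    have : (0 : ℝ) ≤ 1 / r := by positivity
    linarith
  obtain ⟨N₁, hN₁⟩ := exists_nat_ge (N₀ + 2 * (1 + ε) / ε)
  have hN₁0 : (N₀ : ℝ) ≤ N₁ := by
    have : 0 ≤ 2 * (1 + ε) / ε := by positivity
    linarith
  have hN₁ε : 1 + ε ≤ N₁ * (ε / 2) := by
    have h1 : 2 * (1 + ε) / ε ≤ N₁ := by
      have : (0 : ℝ) ≤ N₀ := by positivity
      linarith
    rw [div_le_iff₀ hε] at h1
    linarith
  -- the constant `N₁ ^ 2` absorbs the sets that are too small for the minimum degree form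
  have key : ∀ m : ℕ, ∀ {V : Type u} [DecidableEq V] (G : SimpleGraph V) [DecidableRel G.Adj]
      (S : Finset V), #S = m →
      (¬ ∃ A : Fin (r + 1) → Finset V, (∀ i, A i ⊆ S) ∧ (∀ i, #(A i) = t) ∧
        G.IsCompleteFamily A) →
      (#{p ∈ S ×ˢ S | G.Adj p.1 p.2} : ℝ) ≤ (b + ε * (3 / 4)) * (m : ℝ) ^ 2 + (N₁ : ℝ) ^ 2 := by
    intro m
    induction m with
    | zero =>
      intro V _ G _ S hS _
      rw [card_eq_zero.1 hS]
      simp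
    | succ m ih =>
      intro V _ G _ S hS hno
      by_cases hm : m + 1 ≤ N₁
      · have h1 : #{p ∈ S ×ˢ S | G.Adj p.1 p.2} ≤ (m + 1) * (m + 1) := by
          simpa [hS] using card_filter_le (S ×ˢ S) fun p => G.Adj p.1 p.2
        have h2 : (m + 1) * (m + 1) ≤ N₁ ^ 2 := by rw [sq]; exact Nat.mul_le_mul hm hm
        have h3 : (#{p ∈ S ×ˢ S | G.Adj p.1 p.2} : ℝ) ≤ (N₁ : ℝ) ^ 2 := by
          exact_mod_cast h1.trans h2
        have hb0 : 0 ≤ b := by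
          rw [hb]
          rcases Nat.eq_zero_or_pos r with rfl | hr
          · simp
          · have : (1 : ℝ) ≤ r := by exact_mod_cast hr
            have : 1 / (r : ℝ) ≤ 1 := by rw [div_le_one (by linarith)]; exact this
            linarith
        have : 0 ≤ (b + ε * (3 / 4)) * ((m + 1 : ℕ) : ℝ) ^ 2 := by positivity
        linarith
      · push Not at hm
        have hmN : (N₁ : ℝ) ≤ ((m + 1 : ℕ) : ℝ) := by exact_mod_cast hm.le
        have hlow : ∃ v ∈ S, (#{w ∈ S | G.Adj v w} : ℝ) < (b + ε / 2) * #S := by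
          by_contra! h
          refine hno (hN₀ G S ?_ h)
          rw [hS]
          exact_mod_cast hN₁0.trans hmN
        obtain ⟨v, hv, hlt⟩ := hlow
        have hcard : #(S \ {v}) = m := by
          rw [sdiff_singleton_eq_erase, card_erase_of_mem hv, hS, Nat.add_sub_cancel]
        have h1 := ih G (S \ {v}) hcard fun ⟨A, hA, hA'⟩ =>
          hno ⟨A, fun i => (hA i).trans sdiff_subset, hA'⟩
        have h2 := G.card_filter_adj_le_sdiff S {v}
        rw [sum_singleton] at h2
        have h3 : (#{p ∈ S ×ˢ S | G.Adj p.1 p.2} : ℝ) ≤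
            #{p ∈ (S \ {v}) ×ˢ (S \ {v}) | G.Adj p.1 p.2} + 2 * #{w ∈ S | G.Adj v w} := by
          exact_mod_cast h2
        rw [hS] at hlt
        push_cast at hlt hmN ⊢
        have h4 : 1 + ε ≤ (m + 1) * (ε / 2) := hN₁ε.trans (by gcongr)
        nlinarith
  obtain ⟨N₂, hN₂⟩ := exists_nat_gt ((N₁ : ℝ) ^ 2 / (ε / 4))
  refine ⟨N₂ + 1, fun {V} _ G _ S hS hlt => ?_⟩
  by_contra hno
  have h1 := key #S G S rfl hno
  have h2 : ((N₂ : ℝ) + 1) ≤ #S := by exact_mod_cast hS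
  rw [div_lt_iff₀ (by positivity)] at hN₂
  have h0 : (0 : ℝ) ≤ N₂ := by positivity
  have h3 : (#S : ℝ) ≤ (#S : ℝ) ^ 2 := by nlinarith
  nlinarith

end ErdosStone

/-! ### Stability -/

section Stability
open Finset

universe u

/-- In a dense enough graph almost all vertices have almost the average degree of a Turán graph:
removing many vertices of smaller degree would leave a graph violating the Erdős–Stone bound. -/
theorem MultipartiteEdgeFree.exists_card_low_degree_le {k s : ℕ} (hk : 0 < k) (hs : 0 < s) {a : ℝ}
    (ha : 0 < a) (ha' : a ≤ 1 / 2) :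
    ∃ N : ℕ, ∀ {V : Type u} [Fintype V] [DecidableEq V] (G : SimpleGraph V) [DecidableRel G.Adj],
      N ≤ Fintype.card V → G.MultipartiteEdgeFree k s →
      (1 - 1 / k - a ^ 2 / 8) * (Fintype.card V : ℝ) ^ 2 ≤
        (#{p : V × V | G.Adj p.1 p.2} : ℝ) →
      (#{v | (#{w | G.Adj v w} : ℝ) < (1 - 1 / k - a) * Fintype.card V} : ℝ)
        ≤ a * Fintype.card V := by
  obtain ⟨N₀, hN₀⟩ := exists_isCompleteFamily_of_lt_card_adj.{u}
    (show (0 : ℝ) < a ^ 2 / 8 by positivity) k s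
  obtain ⟨N₁, hN₁⟩ := exists_nat_ge (2 / a)
  refine ⟨2 * N₀ + N₁, fun {V} _ _ G _ hN hG hdens => ?_⟩
  set n := Fintype.card V with hn
  set κ : ℝ := 1 - 1 / k with hκ
  have hκ1 : κ ≤ 1 := by
    have : (0 : ℝ) ≤ 1 / k := by positivity
    linarith
  have hκ0 : 0 ≤ κ := by
    have : (1 : ℝ) ≤ k := by exact_mod_cast hk
    have : 1 / (k : ℝ) ≤ 1 := by rw [div_le_one (by linarith)]; exact this
    linarith
  set L : Finset V := {v | (#{w | G.Adj v w} : ℝ) < (κ - a) * n} with hL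
  by_contra! hlt
  have hnN : (2 * N₀ + N₁ : ℝ) ≤ n := by exact_mod_cast hN
  have hN₀0 : (0 : ℝ) ≤ N₀ := by positivity
  have hN₁0 : (0 : ℝ) ≤ N₁ := by positivity
  have han : 2 ≤ a * n := by
    rw [div_le_iff₀ ha] at hN₁
    nlinarith
  set l := ⌊a * n⌋₊ with hl
  have hla : (l : ℝ) ≤ a * n := Nat.floor_le (by positivity)
  have hla' : a * n - 1 ≤ l := by
    have := Nat.lt_floor_add_one (a * n)
    linarith
  have hlL : l ≤ #L := by
    have : (l : ℝ) ≤ #L := hla.trans hlt.le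
    exact_mod_cast this
  obtain ⟨L', hL'L, hL'⟩ := exists_subset_card_eq hlL
  have hdel := G.card_filter_adj_le_sdiff univ L'
  set S := (univ : Finset V) \ L' with hS
  have hScard : (#S : ℝ) = n - l := by
    have h1 : #S = n - l := by rw [hS, card_univ_sdiff, hL']
    have h2 : l ≤ n := hL' ▸ card_le_univ L'
    rw [h1, Nat.cast_sub h2]
  have hSN : N₀ ≤ #S := by
    have : (N₀ : ℝ) ≤ #S := by rw [hScard]; nlinarith
    exact_mod_cast this
  have hedges : (#{p ∈ S ×ˢ S | G.Adj p.1 p.2} : ℝ) ≤ (κ + a ^ 2 / 8) * (#S : ℝ) ^ 2 := by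
    by_contra! h
    obtain ⟨A, -, hAs, hA⟩ := hN₀ G S hSN h
    obtain ⟨x, hx⟩ : (A (Fin.last k)).Nonempty := card_pos.1 (by rw [hAs]; exact hs)
    obtain ⟨i, hi⟩ := hG.exists_card_lt_of_adj hk hs (A := fun i => A i.castSucc)
      (fun i j hij => hA _ _ (by simpa using hij)) (v := x)
      fun i y hy => hA _ _ (Fin.castSucc_lt_last i).ne' x hx y hy
    exact hi.ne (hAs _)
  have hsum : ∑ v ∈ L', (#{w | G.Adj v w} : ℝ) ≤ l * ((κ - a) * n) := by
    have := sum_le_card_nsmul L' (fun v => (#{w | G.Adj v w} : ℝ)) ((κ - a) * n) fun v hv =>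
      (mem_filter.1 (hL'L hv)).2.le
    rwa [hL', nsmul_eq_mul] at this
  have hdel' : (#{p : V × V | G.Adj p.1 p.2} : ℝ) ≤
      #{p ∈ S ×ˢ S | G.Adj p.1 p.2} + 2 * ∑ v ∈ L', (#{w | G.Adj v w} : ℝ) := by
    rw [univ_product_univ] at hdel
    exact_mod_cast hdel
  rw [hScard] at hedges
  have hn0 : (0 : ℝ) ≤ n := by positivity
  have hl0 : (0 : ℝ) ≤ l := by positivity
  have h1 : (κ + a ^ 2 / 8) * ((n : ℝ) - l) ^ 2 ≤
      κ * n ^ 2 - 2 * κ * n * l + l ^ 2 + a ^ 2 / 8 * n ^ 2 := by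
    have h2 : κ * (l : ℝ) ^ 2 ≤ l ^ 2 := mul_le_of_le_one_left (by positivity) hκ1
    have h3 : ((n : ℝ) - l) ^ 2 ≤ n ^ 2 := by
      have : (l : ℝ) ≤ n := by nlinarith
      nlinarith
    have h4 : a ^ 2 / 8 * ((n : ℝ) - l) ^ 2 ≤ a ^ 2 / 8 * n ^ 2 := by gcongr
    linarith
  have h5 : 2 * l * a * n - (l : ℝ) ^ 2 ≤ a ^ 2 / 4 * n ^ 2 := by linarith
  have h6 : (l : ℝ) ^ 2 ≤ l * (a * n) := by rw [sq]; gcongr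
  have h7 : (a * n - 1) * (a * n) ≤ l * (a * n) := by gcongr
  have h8 : 2 * (a * n) ≤ a * n * (a * n) := by gcongr
  linarith

/-- Colour every vertex by the index of a part of a fixed large complete family in which it has few
neighbours. Vertices with more than half of each other part as neighbours are independent
within their colour class, and the degrees of the family leave few other vertices. -/
theorem MultipartiteEdgeFree.exists_coloring_of_isCompleteFamily {V : Type u} [Fintype V]
    [DecidableEq V] {G : SimpleGraph V} [DecidableRel G.Adj] {k s T : ℕ} (hk : 0 < k) (hs : 0 < s)
    (hT : 2 * s ≤ T) (hG : G.MultipartiteEdgeFree k s) {a : ℝ} {A : Fin k → Finset V}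
    (hA : G.IsCompleteFamily A) (hAT : ∀ i, #(A i) = T)
    (hdeg : ∀ i, ∀ x ∈ A i, (1 - 1 / k - a) * Fintype.card V ≤ (#{w | G.Adj x w} : ℝ)) :
    ∃ c : V → Fin k, (#(G.insidePairs c) : ℝ) * T ≤
      8 * (s + k * a * T) * (Fintype.card V : ℝ) ^ 2 := by
  set n := Fintype.card V with hn
  have hfew (v : V) : ∃ j, #{x ∈ A j | G.Adj v x} < s :=
    hG.exists_card_lt_of_adj hk hs (A := fun j => {x ∈ A j | G.Adj v x})
      (hA.mono fun i => filter_subset _ _) (v := v) fun i y hy => (mem_filter.1 hy).2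
  choose c hc using hfew
  refine ⟨c, ?_⟩
  set Bad : Finset V := {v | ∃ i, i ≠ c v ∧ 2 * #{x ∈ A i | G.Adj v x} < T + s} with hBad
  have hgood (u v : V) (hu : u ∉ Bad) (hv : v ∉ Bad) (huv : G.Adj u v) : c u ≠ c v := by
    intro huvc
    simp only [hBad, mem_filter, mem_univ, true_and, not_exists, not_and, not_lt] at hu hv
    obtain ⟨i, hi⟩ := hG
      (fun i => if i = c u then A i else {x ∈ A i | G.Adj u x ∧ G.Adj v x}) (c u) u v huv
      (hA.mono fun i => by
        split_ifs
        · exact subset_rfl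
        · exact filter_subset _ _)
      (fun i hi y hy => by
        rw [if_neg hi] at hy
        exact (mem_filter.1 hy).2)
    by_cases h : i = c u
    · rw [if_pos h, hAT] at hi
      omega
    · rw [if_neg h] at hi
      have hi' : #({x ∈ A i | G.Adj u x} ∩ {x ∈ A i | G.Adj v x}) < s := by
        rwa [← filter_and]
      have h1 := hu i h
      have h2 := hv i (huvc ▸ h)
      have h3 := card_union_add_card_inter {x ∈ A i | G.Adj u x} {x ∈ A i | G.Adj v x}
      have h4 : #({x ∈ A i | G.Adj u x} ∪ {x ∈ A i | G.Adj v x}) ≤ #(A i) :=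
        card_le_card (union_subset (filter_subset _ _) (filter_subset _ _))
      rw [hAT] at h4
      omega
  have hinside : #(G.insidePairs c) ≤ 2 * (#Bad * n) := by
    have hsub : G.insidePairs c ⊆ Bad ×ˢ univ ∪ univ ×ˢ Bad := by
      rintro ⟨x, y⟩ h
      simp only [insidePairs, mem_filter, mem_univ, true_and] at h
      simp only [mem_union, mem_product, mem_univ, and_true, true_and]
      by_contra! hxy
      exact hgood x y hxy.1 hxy.2 h.1 h.2
    have := (card_le_card hsub).trans (card_union_le _ _)
    rw [card_product, card_product, card_univ, ← hn, mul_comm n] at this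
    omega
  have hTs : (2 * s : ℝ) ≤ T := by exact_mod_cast hT
  have hk1 : (1 : ℝ) ≤ k := by exact_mod_cast hk
  have hpoint (v : V) : 2 * ∑ i, (#{x ∈ A i | G.Adj v x} : ℝ) +
      (if v ∈ Bad then (T - s : ℝ) else 0) ≤ 2 * (s + (k - 1) * T) := by
    have hle (i) : (#{x ∈ A i | G.Adj v x} : ℝ) ≤ T := by
      rw [← hAT i]
      exact_mod_cast card_filter_le _ _
    have hcv : (#{x ∈ A (c v) | G.Adj v x} : ℝ) ≤ s := by exact_mod_cast (hc v).le
    split_ifs with hv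
    · obtain ⟨i₀, hi₀, h⟩ := (mem_filter.1 hv).2
      have h' : 2 * (#{x ∈ A i₀ | G.Adj v x} : ℝ) ≤ T + s := by exact_mod_cast h.le
      have : ∑ i, (#{x ∈ A i | G.Adj v x} : ℝ) ≤
          ∑ i, ((T : ℝ) - (if i = c v then (T - s : ℝ) else 0) -
            (if i = i₀ then (T - s : ℝ) / 2 else 0)) := by
        refine sum_le_sum fun i _ => ?_
        by_cases h1 : i = c v
        · subst h1
          rw [if_pos rfl, if_neg hi₀.symm]
          linarith
        · by_cases h2 : i = i₀
          · subst h2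
            rw [if_neg h1, if_pos rfl]
            linarith
          · rw [if_neg h1, if_neg h2]
            linarith [hle i]
      simp only [sum_sub_distrib, sum_ite_eq', mem_univ, if_true, sum_const, card_univ,
        Fintype.card_fin, nsmul_eq_mul] at this
      linarith
    · have : ∑ i, (#{x ∈ A i | G.Adj v x} : ℝ) ≤
          ∑ i, ((T : ℝ) - (if i = c v then (T - s : ℝ) else 0)) := by
        refine sum_le_sum fun i _ => ?_
        by_cases h1 : i = c v
        · subst h1
          rw [if_pos rfl]
          linarith
        · rw [if_neg h1]
          linarith [hle i]
      simp only [sum_sub_distrib, sum_ite_eq', mem_univ, if_true, sum_const, card_univ,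
        Fintype.card_fin, nsmul_eq_mul] at this
      linarith
  have hdouble : ∑ v, ∑ i, (#{x ∈ A i | G.Adj v x} : ℝ) =
      ∑ i, ∑ x ∈ A i, (#{w | G.Adj x w} : ℝ) := by
    rw [sum_comm]
    refine sum_congr rfl fun i _ => ?_
    simp only [card_filter, Nat.cast_sum]
    rw [sum_comm]
    simp only [G.adj_comm]
  have hlower : (k : ℝ) * (T * ((1 - 1 / k - a) * n)) ≤
      ∑ i, ∑ x ∈ A i, (#{w | G.Adj x w} : ℝ) := by
    have h1 (i : Fin k) : (T : ℝ) * ((1 - 1 / k - a) * n) ≤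
        ∑ x ∈ A i, (#{w | G.Adj x w} : ℝ) := by
      have := card_nsmul_le_sum (A i) _ _ (hdeg i)
      rwa [hAT, nsmul_eq_mul] at this
    have := card_nsmul_le_sum univ _ _ fun i (_ : i ∈ (univ : Finset (Fin k))) => h1 i
    rwa [card_univ, Fintype.card_fin, nsmul_eq_mul] at this
  have hsum := sum_le_sum fun v (_ : v ∈ (univ : Finset V)) => hpoint v
  rw [sum_add_distrib, ← mul_sum, hdouble, sum_const, card_univ, ← hn, nsmul_eq_mul,
    ← sum_filter, filter_mem_eq_inter, univ_inter, sum_const, nsmul_eq_mul] at hsum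
  have hkk : (k : ℝ) * (T * ((1 - 1 / k - a) * n)) = ((k - 1) * T - k * a * T) * n := by
    field_simp
  have hbad : (#Bad : ℝ) * T ≤ 4 * (s + k * a * T) * n := by
    have h1 : (#Bad : ℝ) * T ≤ 2 * (#Bad * (T - s)) := by
      have : (0 : ℝ) ≤ #Bad := by positivity
      nlinarith
    nlinarith
  have hinside' : (#(G.insidePairs c) : ℝ) ≤ 2 * (#Bad * n) := by exact_mod_cast hinside
  have hn0 : (0 : ℝ) ≤ n := by positivity
  calc (#(G.insidePairs c) : ℝ) * T ≤ 2 * (#Bad * n) * T := by gcongr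
    _ = 2 * n * (#Bad * T) := by ring
    _ ≤ 2 * n * (4 * (s + k * a * T) * n) := by gcongr
    _ = _ := by ring

/-- The stability theorem: a graph with almost as many edges as the Turán graph is almost
`k`-partite. -/
theorem MultipartiteEdgeFree.exists_card_insidePairs_le {k s : ℕ} (hk : 2 ≤ k) (hs : 0 < s)
    {ε : ℝ} (hε : 0 < ε) :
    ∃ δ : ℝ, 0 < δ ∧ ∃ N : ℕ, ∀ {V : Type u} [Fintype V] [DecidableEq V] (G : SimpleGraph V)
      [DecidableRel G.Adj], N ≤ Fintype.card V → G.MultipartiteEdgeFree k s →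
      (1 - 1 / k - δ) * (Fintype.card V : ℝ) ^ 2 ≤ (#{p : V × V | G.Adj p.1 p.2} : ℝ) →
      ∃ c : V → Fin k, (#(G.insidePairs c) : ℝ) ≤ ε * (Fintype.card V : ℝ) ^ 2 := by
  obtain ⟨r, rfl⟩ : ∃ r, k = r + 1 := ⟨k - 1, by omega⟩
  have hr : (1 : ℝ) ≤ r := by exact_mod_cast (by omega : 1 ≤ r)
  set ε₁ : ℝ := 1 / (4 * (r * (r + 1))) with hε₁
  have hε₁0 : 0 < ε₁ := by positivity
  obtain ⟨a, ha, ha2, haε₁, haε⟩ : ∃ a : ℝ, 0 < a ∧ a ≤ 1 / 2 ∧ a ≤ ε₁ ∧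
      16 * ((r + 1) * a) ≤ ε := by
    refine ⟨min (1 / 2) (min ε₁ (ε / (16 * (r + 1)))), by positivity, min_le_left _ _,
      (min_le_right _ _).trans (min_le_left _ _), ?_⟩
    have h : min (1 / 2) (min ε₁ (ε / (16 * (r + 1)))) ≤ ε / (16 * (r + 1)) :=
      (min_le_right _ _).trans (min_le_right _ _)
    rw [le_div_iff₀ (by positivity)] at h
    linarith
  obtain ⟨T, hTs, hTε⟩ : ∃ T : ℕ, 2 * s ≤ T ∧ 16 * (s : ℝ) ≤ ε * T := by
    obtain ⟨T₀, hT₀⟩ := exists_nat_ge (16 * s / ε)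
    refine ⟨2 * s + T₀, by omega, ?_⟩
    rw [div_le_iff₀ hε] at hT₀
    push_cast
    have : 0 ≤ ε * (2 * s) := by positivity
    linarith
  have hT0 : (0 : ℝ) < T := by exact_mod_cast (by omega : 0 < T)
  obtain ⟨N₀, hN₀⟩ := exists_card_low_degree_le.{u} (Nat.succ_pos r) hs ha ha2
  obtain ⟨N₁, hN₁⟩ := exists_isCompleteFamily_of_lt_card_adj.{u} hε₁0 r T
  refine ⟨a ^ 2 / 8, by positivity, N₀ + 2 * N₁ + 1, fun {V} _ _ G _ hN hG hdens => ?_⟩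
  have hlow := hN₀ G (by omega) hG hdens
  set n := Fintype.card V with hn
  set κ : ℝ := 1 - 1 / ((r + 1 : ℕ) : ℝ) with hκ
  set L : Finset V := {v | (#{w | G.Adj v w} : ℝ) < (κ - a) * n} with hL
  have hdel := G.card_filter_adj_le_sdiff univ L
  set S := (univ : Finset V) \ L with hS
  have hSn : #S ≤ n := card_le_univ S
  have hScard : (#S : ℝ) = n - #L := by
    rw [hS, card_univ_sdiff, Nat.cast_sub (card_le_univ L)]
  have hn1 : (2 * N₁ + 1 : ℝ) ≤ n := by exact_mod_cast (by omega : 2 * N₁ + 1 ≤ n)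
  have hn0 : (0 : ℝ) < n := by
    have : (0 : ℝ) ≤ N₁ := by positivity
    linarith
  have hSN : N₁ ≤ #S := by
    have : (N₁ : ℝ) ≤ #S := by rw [hScard]; nlinarith
    exact_mod_cast this
  have hsum : ∑ v ∈ L, (#{w | G.Adj v w} : ℝ) ≤ #L * n := by
    have := sum_le_card_nsmul L (fun v => (#{w | G.Adj v w} : ℝ)) n fun v hv => by
      exact_mod_cast card_le_univ _
    rwa [nsmul_eq_mul] at this
  have hdel' : (#{p : V × V | G.Adj p.1 p.2} : ℝ) ≤
      #{p ∈ S ×ˢ S | G.Adj p.1 p.2} + 2 * ∑ v ∈ L, (#{w | G.Adj v w} : ℝ) := by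
    rw [univ_product_univ] at hdel
    exact_mod_cast hdel
  have hκr : κ = 1 - 1 / r + 4 * ε₁ := by
    rw [hκ, hε₁]
    push_cast
    field_simp
    ring
  have hb0 : (0 : ℝ) ≤ 1 - 1 / r := by
    have : 1 / (r : ℝ) ≤ 1 := by rw [div_le_one (by linarith)]; exact hr
    linarith
  obtain ⟨A, hAS, hAT, hA⟩ := hN₁ G S hSN (by
    have h1 : (1 - 1 / r + ε₁) * (#S : ℝ) ^ 2 ≤ (1 - 1 / r + ε₁) * (n : ℝ) ^ 2 := by gcongr
    have h2 : (#L : ℝ) * n ≤ a * n * n := by gcongr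
    have h3 : 0 < (ε₁ - a ^ 2 / 8) * (n : ℝ) ^ 2 := by
      apply mul_pos _ (by positivity)
      nlinarith
    have h4 : a * (n : ℝ) ^ 2 ≤ ε₁ * (n : ℝ) ^ 2 := by gcongr
    rw [hκr] at hdens
    nlinarith)
  obtain ⟨c, hc⟩ := hG.exists_coloring_of_isCompleteFamily (Nat.succ_pos r) hs hTs hA hAT
    (a := a) fun i x hx => by
      by_contra! h
      exact (Finset.mem_sdiff.1 (hAS i hx)).2 (mem_filter.2 ⟨mem_univ _, h⟩)
  refine ⟨c, le_of_mul_le_mul_right (hc.trans ?_) hT0⟩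
  rw [← hn]
  have h1 : 8 * ((s : ℝ) + ((r + 1 : ℕ) : ℝ) * a * T) ≤ ε * T := by
    push_cast
    nlinarith
  nlinarith [mul_le_mul_of_nonneg_right h1 (sq_nonneg (n : ℝ))]

end Stability

/-! ### Colourings with the fewest monochromatic edges -/

section MaxCut
open Finset

universe u
variable {V : Type u} [Fintype V]

theorem card_insidePairs_eq [DecidableEq V] (G : SimpleGraph V) [DecidableRel G.Adj] {k : ℕ}
    (c : V → Fin k) (v : V) : #(G.insidePairs c) =
      #{p ∈ G.insidePairs c | p.1 ≠ v ∧ p.2 ≠ v} + 2 * #{w | G.Adj v w ∧ c w = c v} := by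
  have h1 : #{p ∈ G.insidePairs c | p.1 = v} = #{w | G.Adj v w ∧ c w = c v} := by
    rw [← card_image_of_injective ({w | G.Adj v w ∧ c w = c v} : Finset V)
      (Prod.mk_right_injective v)]
    refine congrArg card ?_
    ext ⟨x, y⟩
    simp only [insidePairs, mem_filter, mem_univ, true_and, mem_image, Prod.mk.injEq]
    constructor
    · rintro ⟨⟨h, h'⟩, rfl⟩
      exact ⟨y, ⟨h, h'.symm⟩, rfl, rfl⟩
    · rintro ⟨w, ⟨h, h'⟩, rfl, rfl⟩
      exact ⟨⟨h, h'.symm⟩, rfl⟩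
  have h2 : #{p ∈ {p ∈ G.insidePairs c | ¬ p.1 = v} | p.2 = v} =
      #{w | G.Adj v w ∧ c w = c v} := by
    rw [← card_image_of_injective ({w | G.Adj v w ∧ c w = c v} : Finset V)
      (Prod.mk_left_injective v)]
    refine congrArg card ?_
    ext ⟨x, y⟩
    simp only [insidePairs, mem_filter, mem_univ, true_and, mem_image, Prod.mk.injEq]
    constructor
    · rintro ⟨⟨⟨h, h'⟩, -⟩, rfl⟩
      exact ⟨x, ⟨h.symm, h'⟩, rfl, rfl⟩
    · rintro ⟨w, ⟨h, h'⟩, rfl, rfl⟩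
      exact ⟨⟨⟨h.symm, h'⟩, h.ne'⟩, rfl⟩
  have h3 : #{p ∈ {p ∈ G.insidePairs c | ¬ p.1 = v} | ¬ p.2 = v} =
      #{p ∈ G.insidePairs c | p.1 ≠ v ∧ p.2 ≠ v} := by rw [filter_filter]
  have h4 := card_filter_add_card_filter_not (s := G.insidePairs c) fun p => p.1 = v
  have h5 := card_filter_add_card_filter_not (s := {p ∈ G.insidePairs c | ¬ p.1 = v})
    fun p => p.2 = v
  omega

/-- In a colouring with the fewest monochromatic edges no vertex gains by changing its colour. -/
theorem card_adj_same_colour_le [DecidableEq V] {G : SimpleGraph V} [DecidableRel G.Adj] {k : ℕ}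
    {c : V → Fin k}
    (hc : ∀ c' : V → Fin k, #(G.insidePairs c) ≤ #(G.insidePairs c')) (v : V) (j : Fin k) :
    #{w | G.Adj v w ∧ c w = c v} ≤ #{w | G.Adj v w ∧ c w = j} := by
  have h := hc (Function.update c v j)
  rw [G.card_insidePairs_eq c v, G.card_insidePairs_eq (Function.update c v j) v] at h
  have h1 : {p ∈ G.insidePairs (Function.update c v j) | p.1 ≠ v ∧ p.2 ≠ v} =
      {p ∈ G.insidePairs c | p.1 ≠ v ∧ p.2 ≠ v} := by
    ext ⟨x, y⟩
    simp only [insidePairs, mem_filter, mem_univ, true_and]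
    refine and_congr_left fun ⟨hx, hy⟩ => ?_
    rw [Function.update_of_ne hx, Function.update_of_ne hy]
  have h2 : ({w | G.Adj v w ∧ Function.update c v j w = Function.update c v j v} : Finset V) =
      ({w | G.Adj v w ∧ c w = j} : Finset V) := by
    ext w
    simp only [mem_filter, mem_univ, true_and]
    refine and_congr_right fun hw => ?_
    rw [Function.update_self, Function.update_of_ne hw.ne']
  rw [h1, h2] at h
  omega

theorem card_adj_add_card_missingPairs (G : SimpleGraph V) [DecidableRel G.Adj] {k : ℕ}
    (c : V → Fin k) : #{p : V × V | G.Adj p.1 p.2} + #(G.missingPairs c) =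
      #(G.insidePairs c) + #{p : V × V | c p.1 ≠ c p.2} := by
  have h1 := card_filter_add_card_filter_not (s := ({p : V × V | G.Adj p.1 p.2} : Finset (V × V)))
    fun p => c p.1 = c p.2
  have h2 := card_filter_add_card_filter_not (s := ({p : V × V | c p.1 ≠ c p.2} : Finset (V × V)))
    fun p => G.Adj p.1 p.2
  simp only [filter_filter] at h1 h2
  have h3 : ({p : V × V | c p.1 ≠ c p.2 ∧ G.Adj p.1 p.2} : Finset (V × V)) =
      ({p : V × V | G.Adj p.1 p.2 ∧ ¬ c p.1 = c p.2} : Finset (V × V)) :=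
    filter_congr fun p _ => and_comm
  have h4 : G.missingPairs c = ({p : V × V | c p.1 ≠ c p.2 ∧ ¬ G.Adj p.1 p.2} : Finset (V × V)) :=
    filter_congr fun p _ => and_comm
  rw [h3] at h2
  rw [h4, insidePairs]
  omega

theorem card_cross_pairs_le {k : ℕ} (c : V → Fin k) :
    #{p : V × V | c p.1 ≠ c p.2} ≤ 2 * turanNumber k (Fintype.card V) := by
  have hcol : ((⊤ : SimpleGraph (Fin k)).comap c).Colorable k :=
    ⟨Coloring.mk c fun {x y} hxy => hxy⟩
  have h := (hcol.cliqueFree (Nat.lt_succ_self k)).card_edgeFinset_le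
  rw [turanNumber, card_edgeFinset_turanGraph]
  have h2 := two_mul_card_edgeFinset ((⊤ : SimpleGraph (Fin k)).comap c)
  have h3 : #{p : V × V | c p.1 ≠ c p.2} =
      #(univ.filter fun (x, y) => ((⊤ : SimpleGraph (Fin k)).comap c).Adj x y) := by
    congr 1
  rw [h3, ← h2]
  exact Nat.mul_le_mul_left 2 h

theorem le_two_mul_turanNumber {k : ℕ} (hk : 0 < k) (n : ℕ) :
    (1 - 1 / k) * (n : ℝ) ^ 2 - (k ^ 2 + 2) ≤ 2 * (turanNumber k n : ℝ) := by
  rw [turanNumber, card_edgeFinset_turanGraph]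
  have hr : n % k < k := Nat.mod_lt n hk
  set r := n % k with hr'
  have hrn : r ≤ n := Nat.mod_le n k
  have hk1 : (1 : ℝ) ≤ k := by exact_mod_cast hk
  have h1 : (((n ^ 2 - r ^ 2) * (k - 1) : ℕ) : ℝ) = ((n : ℝ) ^ 2 - r ^ 2) * (k - 1) := by
    rw [Nat.cast_mul, Nat.cast_sub (Nat.pow_le_pow_left hrn 2), Nat.cast_sub hk]
    push_cast
    ring
  have h2 : (((n ^ 2 - r ^ 2) * (k - 1) : ℕ) : ℝ) ≤
      2 * k * (((n ^ 2 - r ^ 2) * (k - 1) / (2 * k) : ℕ) : ℝ) + 2 * k := by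
    have := (Nat.lt_mul_div_succ ((n ^ 2 - r ^ 2) * (k - 1)) (by omega : 0 < 2 * k)).le
    have h : ((n ^ 2 - r ^ 2) * (k - 1) : ℕ) ≤
        2 * k * ((n ^ 2 - r ^ 2) * (k - 1) / (2 * k)) + 2 * k := by
      rw [mul_add, mul_one] at this
      exact this
    exact_mod_cast h
  rw [h1] at h2
  set q : ℝ := (((n ^ 2 - r ^ 2) * (k - 1) / (2 * k) : ℕ) : ℝ)
  have h3 : (1 - 1 / (k : ℝ)) * ((n : ℝ) ^ 2 - r ^ 2) ≤ 2 * q + 2 := by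
    have h4 : (1 - 1 / (k : ℝ)) * ((n : ℝ) ^ 2 - r ^ 2) =
        ((n : ℝ) ^ 2 - r ^ 2) * (k - 1) / k := by field_simp
    rw [h4, div_le_iff₀ (by linarith)]
    linarith
  have h5 : (1 - 1 / (k : ℝ)) * (r : ℝ) ^ 2 ≤ k ^ 2 := by
    have h6 : (r : ℝ) ^ 2 ≤ (k : ℝ) ^ 2 := by
      have : (r : ℝ) ≤ k := by exact_mod_cast hr.le
      gcongr
    have h7 : 1 - 1 / (k : ℝ) ≤ 1 := by
      have : (0 : ℝ) ≤ 1 / k := by positivity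
      linarith
    exact (mul_le_of_le_one_left (by positivity) h7).trans h6
  push_cast
  have : (0 : ℝ) ≤ (r.choose 2 : ℝ) := by positivity
  linarith

/-- The number of bichromatic pairs controls how far a colour class is from the average size: the
right-hand side is the sum of the squared deviations over all classes. -/
theorem sq_card_class_sub_le {k : ℕ} (hk : 0 < k) (c : V → Fin k) (j : Fin k) :
    ((#{w | c w = j} : ℝ) - Fintype.card V / k) ^ 2 ≤
      (1 - 1 / k) * (Fintype.card V : ℝ) ^ 2 - #{p : V × V | c p.1 ≠ c p.2} := by
  set n := Fintype.card V with hn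
  have hk0 : (k : ℝ) ≠ 0 := by exact_mod_cast hk.ne'
  have h1 : ∑ i, (#{w | c w = i} : ℝ) = n := by
    have := card_eq_sum_card_fiberwise (f := c) (s := univ) (t := univ) (by simp)
    rw [card_univ] at this
    exact_mod_cast this.symm
  have h2 : #{p : V × V | c p.1 = c p.2} = ∑ i, #{w | c w = i} ^ 2 := by
    rw [card_eq_sum_card_fiberwise (f := fun p => c p.1) (t := univ) (by simp)]
    refine sum_congr rfl fun i _ => ?_
    rw [sq, ← card_product]
    congr 1
    ext ⟨x, y⟩
    simp only [mem_filter, mem_univ, true_and, mem_product]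
    constructor
    · rintro ⟨h, rfl⟩
      exact ⟨rfl, h.symm⟩
    · rintro ⟨rfl, h⟩
      exact ⟨h.symm, rfl⟩
  have h3 := card_filter_add_card_filter_not (s := (univ : Finset (V × V)))
    fun p => c p.1 = c p.2
  rw [h2, card_univ, Fintype.card_prod, ← hn] at h3
  have h4 : (∑ i, (#{w | c w = i} : ℝ) ^ 2) + #{p : V × V | c p.1 ≠ c p.2} = (n : ℝ) ^ 2 := by
    rw [sq (n : ℝ)]
    exact_mod_cast h3
  calc ((#{w | c w = j} : ℝ) - n / k) ^ 2
      ≤ ∑ i, ((#{w | c w = i} : ℝ) - n / k) ^ 2 :=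
        single_le_sum (f := fun i => ((#{w | c w = i} : ℝ) - n / k) ^ 2)
          (fun i _ => sq_nonneg _) (mem_univ j)
    _ = ∑ i, (#{w | c w = i} : ℝ) ^ 2 - 2 * (n / k) * ∑ i, (#{w | c w = i} : ℝ) +
          k * (n / k : ℝ) ^ 2 := by
        simp only [sub_sq, sum_add_distrib, sum_sub_distrib, sum_const, card_univ,
          Fintype.card_fin, nsmul_eq_mul, mul_sum]
        congr 2
        exact sum_congr rfl fun i _ => by ring
    _ = (1 - 1 / k) * (n : ℝ) ^ 2 - #{p : V × V | c p.1 ≠ c p.2} := by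
        rw [h1, ← h4]
        field_simp
        rw [← h4]
        ring

/-- Every monochromatic edge has an end that lies in many missing pairs, so there are few such ends.
By the choice of the colouring, a vertex with `d` neighbours of its own colour has `d` neighbours in
each class, which forces about `(d / s) ^ 2` missing pairs. -/
theorem MultipartiteEdgeFree.card_insidePairs_mul_le [DecidableEq V] {G : SimpleGraph V}
    [DecidableRel G.Adj]
    {k s : ℕ} (hk : 0 < k) (hs : 0 < s) (hG : G.MultipartiteEdgeFree k s) {c : V → Fin k}
    (hc : ∀ c' : V → Fin k, #(G.insidePairs c) ≤ #(G.insidePairs c'))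
    (hclass : ∀ j, 3 * (Fintype.card V : ℝ) / (4 * k) ≤ (#{w | c w = j} : ℝ))
    (hn : 8 * k * s ≤ Fintype.card V)
    (hM : (#(G.missingPairs c) : ℝ) < ((Fintype.card V : ℝ) / (8 * k * s)) ^ 2) :
    (#(G.insidePairs c) : ℝ) * Fintype.card V ≤
      32 * k * s * (#(G.missingPairs c) * √(#(G.missingPairs c))) := by
  set n := Fintype.card V with hn'
  set M : ℝ := (#(G.missingPairs c) : ℝ) with hM'
  have hk1 : (1 : ℝ) ≤ k := by exact_mod_cast hk
  have hs1 : (1 : ℝ) ≤ s := by exact_mod_cast hs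
  have hnks : (8 * k * s : ℝ) ≤ n := by exact_mod_cast hn
  have hn8k : 8 * (k : ℝ) ≤ n := by nlinarith
  have hn0 : (0 : ℝ) < n := by linarith
  have hM0 : 0 ≤ M := by positivity
  have hdiv (d : ℕ) : (d : ℝ) ≤ s * ((d / s : ℕ) + 1) := by
    exact_mod_cast (Nat.lt_mul_div_succ d hs).le
  -- the number of neighbours of a vertex in its own class
  have hdeg (v : V) : (#{w | G.Adj v w ∧ c w = c v} : ℝ) ≤ s * (√M + 1) := by
    have h1 := hG.sq_le_card_missingPairs_of_vertex hk hs c v (card_adj_same_colour_le hc v)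
    set d := #{w | G.Adj v w ∧ c w = c v}
    have h2 : ((d / s : ℕ) : ℝ) ≤ √M := by
      apply Real.le_sqrt_of_sq_le
      rw [hM']
      exact_mod_cast h1
    refine (hdiv d).trans ?_
    gcongr
  set B : Finset V := {v | (n : ℝ) / (8 * k) ≤ #{w | ¬ G.Adj v w ∧ c v ≠ c w}} with hB
  have hcover (u v : V) (huv : G.Adj u v) (hcuv : c u = c v) : u ∈ B ∨ v ∈ B := by
    by_contra! h
    simp only [hB, mem_filter, mem_univ, true_and, not_le] at h
    obtain ⟨hu, hv⟩ := h
    set d := ⌈(n : ℝ) / (4 * k)⌉₊ with hd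
    have hd1 : (n : ℝ) / (4 * k) ≤ d := Nat.le_ceil _
    have hd2 : (d : ℝ) ≤ n / (4 * k) + 1 := (Nat.ceil_lt_add_one (by positivity)).le
    have hq : (n : ℝ) / (4 * k) = 2 * (n / (8 * k)) := by field_simp; ring
    have hq' : 3 * (n : ℝ) / (4 * k) = 6 * (n / (8 * k)) := by field_simp; ring
    have hq1 : 1 ≤ (n : ℝ) / (8 * k) := by rw [le_div_iff₀ (by positivity)]; linarith
    have h1 := hG.sq_le_card_missingPairs_of_edge (d := d) c huv (c u)
      (by
        have := hclass (c u)
        have : (d : ℝ) ≤ #{w | c w = c u} := by linarith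
        exact_mod_cast this)
      (by
        intro i hi
        have hsub : ({w | c w = i} : Finset V) ⊆
            ({w | G.Adj u w ∧ G.Adj v w ∧ c w = i} : Finset V) ∪
              (({w | ¬ G.Adj u w ∧ c u ≠ c w} : Finset V) ∪
                ({w | ¬ G.Adj v w ∧ c v ≠ c w} : Finset V)) := by
          intro w hw
          simp only [mem_filter, mem_univ, true_and, mem_union] at hw ⊢
          subst hw
          have hi' : ¬ c v = c w := hcuv ▸ hi.symm
          have hi'' : ¬ c u = c w := hi.symm
          tauto
        have h2 := (card_le_card hsub).trans ((card_union_le _ _).trans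
          (Nat.add_le_add_left (card_union_le _ _) _))
        have h3 : (#{w | c w = i} : ℝ) ≤ #{w | G.Adj u w ∧ G.Adj v w ∧ c w = i} +
            (#{w | ¬ G.Adj u w ∧ c u ≠ c w} + #{w | ¬ G.Adj v w ∧ c v ≠ c w}) := by
          exact_mod_cast h2
        have h4 := hclass i
        have : (d : ℝ) ≤ #{w | G.Adj u w ∧ G.Adj v w ∧ c w = i} := by linarith
        exact_mod_cast this)
    have h2 : (n : ℝ) / (8 * k * s) ≤ (d / s : ℕ) := by
      have h3 := hdiv d
      have h4 : 1 ≤ (n : ℝ) / (8 * k * s) := by rw [le_div_iff₀ (by positivity)]; linarith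
      have h5 : (n : ℝ) / (4 * k) = s * (2 * (n / (8 * k * s))) := by field_simp; ring
      have h6 : 2 * ((n : ℝ) / (8 * k * s)) ≤ (d / s : ℕ) + 1 := by
        refine le_of_mul_le_mul_left ?_ (by linarith : (0 : ℝ) < s)
        linarith
      linarith
    have h3 : ((n : ℝ) / (8 * k * s)) ^ 2 ≤ ((d / s : ℕ) : ℝ) ^ 2 := by gcongr
    have h4 : ((d / s : ℕ) : ℝ) ^ 2 ≤ M := by
      rw [hM']
      exact_mod_cast h1
    linarith
  have hinside : #(G.insidePairs c) ≤ 2 * ∑ v ∈ B, #{w | G.Adj v w ∧ c w = c v} := by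
    have hfib : ∑ v ∈ B, #{w | G.Adj v w ∧ c w = c v} =
        #{p ∈ B ×ˢ (univ : Finset V) | G.Adj p.1 p.2 ∧ c p.2 = c p.1} := by
      simp only [card_filter, sum_product]
    have hsub : G.insidePairs c ⊆
        {p ∈ B ×ˢ (univ : Finset V) | G.Adj p.1 p.2 ∧ c p.2 = c p.1} ∪
          {p ∈ B ×ˢ (univ : Finset V) | G.Adj p.1 p.2 ∧ c p.2 = c p.1}.image Prod.swap := by
      rintro ⟨x, y⟩ h
      simp only [insidePairs, mem_filter, mem_univ, true_and] at h
      simp only [mem_union, mem_filter, mem_product, mem_univ, and_true, mem_image, Prod.exists,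
        Prod.swap_prod_mk, Prod.mk.injEq]
      rcases hcover x y h.1 h.2 with hx | hy
      · exact Or.inl ⟨hx, h.1, h.2.symm⟩
      · exact Or.inr ⟨y, x, ⟨hy, h.1.symm, h.2⟩, rfl, rfl⟩
    have h1 := (card_le_card hsub).trans (card_union_le _ _)
    have h2 := card_image_le (f := Prod.swap)
      (s := {p ∈ B ×ˢ (univ : Finset V) | G.Adj p.1 p.2 ∧ c p.2 = c p.1})
    rw [hfib]
    omega
  have hBM : (#B : ℝ) * (n / (8 * k)) ≤ M := by
    have h1 := card_nsmul_le_sum B (fun v => (#{w | ¬ G.Adj v w ∧ c v ≠ c w} : ℝ))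
      ((n : ℝ) / (8 * k)) fun v hv => (mem_filter.1 hv).2
    rw [nsmul_eq_mul] at h1
    refine h1.trans ?_
    have h2 : ∑ v ∈ B, #{w | ¬ G.Adj v w ∧ c v ≠ c w} ≤ ∑ v, #{w | ¬ G.Adj v w ∧ c v ≠ c w} :=
      sum_le_sum_of_subset (subset_univ B)
    have h3 : ∑ v, #{w | ¬ G.Adj v w ∧ c v ≠ c w} = #(G.missingPairs c) := by
      rw [missingPairs, ← univ_product_univ]
      simp only [card_filter, sum_product]
    rw [h3] at h2
    rw [hM']
    exact_mod_cast h2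
  have hsum : (#(G.insidePairs c) : ℝ) ≤ 2 * (#B * (s * (√M + 1))) := by
    have h1 := sum_le_card_nsmul B (fun v => (#{w | G.Adj v w ∧ c w = c v} : ℝ)) _
      fun v _ => hdeg v
    rw [nsmul_eq_mul] at h1
    have h2 : (#(G.insidePairs c) : ℝ) ≤ 2 * ∑ v ∈ B, (#{w | G.Adj v w ∧ c w = c v} : ℝ) := by
      exact_mod_cast hinside
    linarith
  have hBn : (#B : ℝ) * n ≤ 8 * k * M := by
    have h1 : (#B : ℝ) * n = 8 * k * (#B * (n / (8 * k))) := by field_simp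
    rw [h1]
    gcongr
  -- the number of missing pairs is an integer, so it is zero or at least one
  have hsqrt : M * (√M + 1) ≤ M * (2 * √M) := by
    rcases Nat.eq_zero_or_pos #(G.missingPairs c) with h | h
    · have : M = 0 := by rw [hM', h, Nat.cast_zero]
      simp [this]
    · have : 1 ≤ √M := Real.one_le_sqrt.2 (by rw [hM']; exact_mod_cast h)
      gcongr
      linarith
  calc (#(G.insidePairs c) : ℝ) * n ≤ 2 * (#B * (s * (√M + 1))) * n := by gcongr
    _ = 2 * s * (√M + 1) * (#B * n) := by ring
    _ ≤ 2 * s * (√M + 1) * (8 * k * M) := by gcongr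
    _ = 16 * k * s * (M * (√M + 1)) := by ring
    _ ≤ 16 * k * s * (M * (2 * √M)) := by gcongr
    _ = _ := by ring

theorem partiteAfterDeleting_of_card_insidePairs_le {G : SimpleGraph V} [DecidableRel G.Adj]
    {k : ℕ} (c : V → Fin k) {r : ℝ} (h : (#(G.insidePairs c) : ℝ) ≤ 2 * r) :
    G.PartiteAfterDeleting k r := by
  classical
  let I : SimpleGraph V :=
    { Adj := fun x y => G.Adj x y ∧ c x = c y
      symm := ⟨fun x y hxy => ⟨hxy.1.symm, hxy.2.symm⟩⟩
      loopless := ⟨fun x hx => G.irrefl hx.1⟩ }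
  refine ⟨I.edgeFinset, ?_, ?_, ⟨Coloring.mk c fun {x y} hxy => ?_⟩⟩
  · rw [coe_edgeFinset]
    exact edgeSet_mono fun x y hxy => hxy.1
  · have h1 := two_mul_card_edgeFinset I
    have h2 : #(univ.filter fun (x, y) => I.Adj x y) = #(G.insidePairs c) := by
      congr 1
    rw [h2] at h1
    have h3 : 2 * (#I.edgeFinset : ℝ) = #(G.insidePairs c) := by exact_mod_cast h1
    linarith
  · rw [deleteEdges_adj, coe_edgeFinset, mem_edgeSet] at hxy
    exact fun hc => hxy.2 ⟨hxy.1, hc⟩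

end MaxCut

/-! ### The quantitative bound -/

section Quantitative
open Finset

universe u

theorem MultipartiteEdgeFree.exists_forall_partiteAfterDeleting {k s : ℕ} (hk : 2 ≤ k)
    (hs : 0 < s) {f : ℕ → ℝ} (hf0 : ∀ n, 0 ≤ f n)
    (hf : f =o[atTop] fun n : ℕ => (n : ℝ) ^ 2) :
    ∃ n₀ : ℕ, ∀ (V : Type u) [Fintype V] [DecidableEq V] (G : SimpleGraph V) [DecidableRel G.Adj],
      n₀ ≤ Fintype.card V → G.MultipartiteEdgeFree k s →
      (turanNumber k (Fintype.card V) : ℝ) - f (Fintype.card V) ≤ (#G.edgeFinset : ℝ) →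
      G.PartiteAfterDeleting k (128 * k * s *
        ((Fintype.card V : ℝ)⁻¹ * f (Fintype.card V) ^ (3 / 2 : ℝ))) := by
  have hk0 : 0 < k := by omega
  have hk1 : (1 : ℝ) ≤ k := by exact_mod_cast hk0
  have hs1 : (1 : ℝ) ≤ s := by exact_mod_cast hs
  -- with this `ε`, the bound `2 * ε * n ^ 2` on the missing pairs is `(n / (64 * k * s)) ^ 2`
  set ε : ℝ := 1 / (8192 * k ^ 2 * s ^ 2) with hε
  have hε0 : 0 < ε := by positivity
  obtain ⟨δ, hδ0, N₁, hN₁⟩ := exists_card_insidePairs_le.{u} hk hs hε0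
  set η := min ε δ with hη
  have hη0 : 0 < η := lt_min hε0 hδ0
  obtain ⟨N₂, hN₂⟩ := eventually_atTop.1 (hf.bound (show 0 < η / 4 by positivity))
  obtain ⟨N₃, hN₃⟩ := exists_nat_ge (2 * ((k : ℝ) ^ 2 + 2) / η)
  refine ⟨N₁ + N₂ + N₃ + 8 * k * s + 1, fun V _ _ G _ hn hG hedges => ?_⟩
  set n := Fintype.card V with hn'
  have hn1 : (1 : ℝ) ≤ n := by exact_mod_cast (by omega : 1 ≤ n)
  have hn0 : (0 : ℝ) < n := by linarith
  set F := f n with hF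
  have hF0 : 0 ≤ F := hf0 n
  have hFn : 2 * F ≤ η / 2 * (n : ℝ) ^ 2 := by
    have := hN₂ n (by omega)
    rw [Real.norm_of_nonneg (hf0 n), Real.norm_of_nonneg (by positivity)] at this
    linarith
  have hkn : (k : ℝ) ^ 2 + 2 ≤ η / 2 * (n : ℝ) ^ 2 := by
    rw [div_le_iff₀ hη0] at hN₃
    have h1 : (N₃ : ℝ) ≤ n := by exact_mod_cast (by omega : N₃ ≤ n)
    have h2 : (n : ℝ) ≤ (n : ℝ) ^ 2 := by nlinarith
    have h3 : (N₃ : ℝ) * η ≤ (n : ℝ) ^ 2 * η := by gcongr; linarith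
    linarith
  have hadj : (#{p : V × V | G.Adj p.1 p.2} : ℝ) = 2 * #G.edgeFinset := by
    exact_mod_cast (two_mul_card_edgeFinset G).symm
  have hturan := le_two_mul_turanNumber hk0 n
  have hηε : η * (n : ℝ) ^ 2 ≤ ε * (n : ℝ) ^ 2 := by
    gcongr
    exact min_le_left _ _
  have hηδ : η * (n : ℝ) ^ 2 ≤ δ * (n : ℝ) ^ 2 := by
    gcongr
    exact min_le_right _ _
  obtain ⟨c₀, hc₀⟩ := hN₁ G (by omega) hG (by rw [← hn', hadj]; linarith)
  obtain ⟨c, -, hc⟩ := exists_min_image univ (fun c : V → Fin k => #(G.insidePairs c))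
    ⟨c₀, mem_univ _⟩
  replace hc := fun c' => hc c' (mem_univ c')
  have hin : (#(G.insidePairs c) : ℝ) ≤ ε * (n : ℝ) ^ 2 := by
    refine le_trans ?_ hc₀
    exact_mod_cast hc c₀
  have hcount : (#{p : V × V | G.Adj p.1 p.2} : ℝ) + #(G.missingPairs c) =
      #(G.insidePairs c) + #{p : V × V | c p.1 ≠ c p.2} := by
    exact_mod_cast G.card_adj_add_card_missingPairs c
  have hcross : (#{p : V × V | c p.1 ≠ c p.2} : ℝ) ≤ 2 * turanNumber k n := by
    exact_mod_cast card_cross_pairs_le c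
  set I : ℝ := (#(G.insidePairs c) : ℝ) with hI
  set M : ℝ := (#(G.missingPairs c) : ℝ) with hM
  have hM0 : 0 ≤ M := by positivity
  have hMI : M ≤ I + 2 * F := by linarith
  have hMsq : M ≤ (n / (64 * k * s)) ^ 2 := by
    have h1 : ((n : ℝ) / (64 * k * s)) ^ 2 = 2 * (ε * n ^ 2) := by
      rw [hε]
      field_simp
      norm_num
    have h2 : 0 ≤ η * (n : ℝ) ^ 2 := by positivity
    rw [h1]
    linarith
  have hclass (j : Fin k) : 3 * (n : ℝ) / (4 * k) ≤ (#{w | c w = j} : ℝ) := by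
    have h1 := sq_card_class_sub_le hk0 c j
    rw [← hn'] at h1
    have h2 : 2 * (ε * (n : ℝ) ^ 2) ≤ (n / (4 * k)) ^ 2 := by
      have h3 : 2 * (ε * (n : ℝ) ^ 2) = (n / (64 * k * s)) ^ 2 := by
        rw [hε]
        field_simp
        norm_num
      have h4 : (n : ℝ) / (64 * k * s) ≤ n / (4 * k) :=
        div_le_div_of_nonneg_left hn0.le (by positivity) (by nlinarith)
      rw [h3]
      gcongr
    have h4 : ((#{w | c w = j} : ℝ) - n / k) ^ 2 ≤ (n / (4 * k)) ^ 2 := by linarith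
    have h5 := (abs_le.1 (abs_le_of_sq_le_sq h4 (by positivity))).1
    have h6 : (n : ℝ) / k = 3 * n / (4 * k) + n / (4 * k) := by field_simp; ring
    linarith
  have hmain := hG.card_insidePairs_mul_le hk0 hs hc hclass (by omega) (by
    refine hMsq.trans_lt ?_
    gcongr
    norm_num)
  rw [← hn', ← hI, ← hM] at hmain
  have hsqrt : √M ≤ n / (64 * k * s) := Real.sqrt_le_iff.2 ⟨by positivity, hMsq⟩
  have hIM : I ≤ M / 2 := by
    refine le_of_mul_le_mul_right (hmain.trans ?_) hn0
    calc 32 * k * s * (M * √M) ≤ 32 * k * s * (M * (n / (64 * k * s))) := by gcongr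
      _ = M / 2 * n := by
        field_simp
        ring
  have hMF : M ≤ 4 * F := by linarith
  have hsqrtF : √M ≤ 2 * √F := by
    rw [Real.sqrt_le_iff]
    refine ⟨by positivity, ?_⟩
    rw [mul_pow, Real.sq_sqrt hF0]
    linarith
  refine partiteAfterDeleting_of_card_insidePairs_le c ?_
  have hrpow : F ^ (3 / 2 : ℝ) = F * √F := by
    rw [Real.sqrt_eq_rpow, show (3 / 2 : ℝ) = 1 + 1 / 2 by norm_num,
      Real.rpow_add_of_nonneg hF0 (by norm_num) (by norm_num), Real.rpow_one]
  rw [hrpow, ← hI]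
  refine le_of_mul_le_mul_right (hmain.trans ?_) hn0
  calc 32 * k * s * (M * √M) ≤ 32 * k * s * (4 * F * (2 * √F)) := by gcongr
    _ = _ := by
      field_simp
      ring

end Quantitative
end SimpleGraph

theorem mainTheorem1 {W : Type*} [Finite W] (H : SimpleGraph W) (k : ℕ) (hk : 3 ≤ k + 1)
    (hχ : H.chromaticNumber = ((k + 1 : ℕ) : ℕ∞)) (hcrit : ∃ e : Sym2 W, H.IsCriticalEdge e) :
    ∃ C : ℝ, 0 < C ∧
      ∀ f : ℕ → ℝ, (∀ n, 0 ≤ f n) → (f =o[atTop] fun n : ℕ => (n : ℝ) ^ 2) →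
        ∃ n₀ : ℕ, ∀ n : ℕ, n₀ ≤ n →
          ∀ (V : Type*) [Fintype V] (G : SimpleGraph V) [DecidableRel G.Adj],
            Fintype.card V = n → H.Free G →
            (turanNumber k n : ℝ) - f n ≤ (G.edgeFinset.card : ℝ) →
            G.PartiteAfterDeleting k (C * ((n : ℝ)⁻¹ * f n ^ (3 / 2 : ℝ))) := by
  classical
  have := Fintype.ofFinite W
  obtain ⟨e, he⟩ := hcrit
  refine ⟨128 * k * (Fintype.card W + 2 : ℕ), ?_, fun f hf0 hf => ?_⟩
  · have : 0 < k := by omega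
    positivity
  obtain ⟨n₀, hn₀⟩ := SimpleGraph.MultipartiteEdgeFree.exists_forall_partiteAfterDeleting
    (k := k) (s := Fintype.card W + 2) (by omega) (by omega) hf0 hf
  refine ⟨n₀, fun n hn V _ G _ hV hG hedges => ?_⟩
  subst hV
  exact hn₀ V G hn (hG.multipartiteEdgeFree hχ he) hedges
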